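/- Let $V$ be a finite set of (distinct) points in the Euclidean plane $\mathbb{R}^2$, weight each edge of the complete graph on $V$ by the Euclidean distance $\overline{uv}$ of its endpoints, and write $w$ for the total weight of a graph or path. Let $T$ be a minimum spanning tree of $V$ in which every vertex has degree at most $5$. Root $T$ at a leaf $r$ (a vertex of degree one; if $V$ is a single point, at that point), and let $\mathrm{child}_T(v)$ be the set of children of $v$ in the rooted tree. For each $v\in V$ let $P_v$ be a path of minimum weight that visits exactly the points of $\{v\}\cup \mathrm{child}_T(v)$, each once (it need not start at $v$). Such an $r$ exists and, for every such $r$, such paths $P_v$ exist. For every choice of a leaf $r$ and of minimum-weight paths $P_v$, $$ w(P_v)\;\le\; 1.25\sum_{v_i\in \mathrm{child}_T(v)} \overline{v v_i}\qquad\text{for every } v\in V, $$ and the union $T_4$ of the paths $P_v$ ($v \in V$) is a spanning tree of $V$ in which every vertex has degree at most $4$, with $$ w(T_4)\;\le\; 1.25\, w(T). $$ -/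

import Mathlib

namespace EuclideanMST

section

variable {V : Type*} [MetricSpace V]

/-- The length of an edge of the complete graph on `V`: the distance between its endpoints. -/
def edgeLength : Sym2 V → ℝ :=
  Sym2.lift ⟨fun a b => dist a b, fun a b => dist_comm a b⟩

open scoped Classical in
/-- The weight `w(T)` of a graph on a finite vertex set: the sum of the lengths of its edges. -/
noncomputable def weight [Fintype V] (T : SimpleGraph V) : ℝ :=
  ∑ e ∈ T.edgeFinset, edgeLength e

/-- `T` is a minimum spanning tree of the complete graph on the points of `V`, each edge
being weighted by the distance between its endpoints. -/
def IsMST [Fintype V] (T : SimpleGraph V) : Prop :=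
  T.IsTree ∧ ∀ T' : SimpleGraph V, T'.IsTree → weight T ≤ weight T'

open scoped Classical in
/-- Every vertex of `T` has degree at most `k`. -/
def DegreeAtMost [Fintype V] (T : SimpleGraph V) (k : ℕ) : Prop :=
  ∀ v : V, T.degree v ≤ k

open scoped Classical in
/-- `r` is a leaf of the tree `T`.  A tree with at least two vertices has no vertex of degree
zero, so there this says that the degree is one; in the tree with a single vertex, that
vertex counts as a leaf. -/
def IsLeaf [Fintype V] (T : SimpleGraph V) (r : V) : Prop :=
  T.degree r ≤ 1

open scoped Classical in
/-- The children of `v` in the tree `T` rooted at `r`: the neighbours of `v` that are one step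
further away from the root than `v`, the distance `T.dist` being the number of edges. -/
noncomputable def children [Fintype V] (T : SimpleGraph V) (r v : V) : Finset V :=
  {u | T.Adj v u ∧ T.dist r u = T.dist r v + 1}

/-- The weight of the path that passes through the points of a list in the given order. -/
noncomputable def pathWeight : List V → ℝ
  | [] => 0
  | [_] => 0
  | a :: b :: l => dist a b + pathWeight (b :: l)

/-- `l` is a path (in the complete graph) that visits each point of `s` exactly once and no
other point, starting and ending anywhere. -/
def IsPathThrough (s : Set V) (l : List V) : Prop :=
  l.Nodup ∧ ∀ x : V, x ∈ l ↔ x ∈ s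

/-- `l` has the least weight among all the paths through the points of `s`. -/
def IsShortestPathThrough (s : Set V) (l : List V) : Prop :=
  IsPathThrough s l ∧ ∀ l' : List V, IsPathThrough s l' → pathWeight l ≤ pathWeight l'

/-- For every vertex `v` of the tree `T` rooted at `r`, `P v` is a shortest path through `v`
and its children. -/
def IsShortestPathFamily [Fintype V] (T : SimpleGraph V) (r : V) (P : V → List V) : Prop :=
  ∀ v : V, IsShortestPathThrough (insert v (children T r v : Set V)) (P v)

/-- The graph on `V` whose edges join the consecutive points of the path `l`. -/
def pathGraph (l : List V) : SimpleGraph V :=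
  SimpleGraph.fromRel (fun a b => [a, b] <:+: l)

/-- The union of the paths `P v`. -/
def unionOfPaths (P : V → List V) : SimpleGraph V :=
  ⨆ v : V, pathGraph (P v)

end

end EuclideanMST

/-! Two edges of a minimum spanning tree with a common endpoint are no longer than the third side of
their triangle, by exchange (`IsMST.dist_le`), so they meet at an angle of at least π/3. As the root
is a leaf, every other vertex v has at most four children; the parent is a further ray at v, so the
directions of the children lie in an arc of at most 4π/3.

Compare a path through v and its children with the star of spokes at v. Covering two children by the
chord between them and the shorter of their spokes d, e costs at most min(d, e)·f more than the two
spokes, where f = 2 sin(α/2) − 1 and α is their angle (`chord_add_min_le`). Each candidate path thus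
has an excess bounded by one or two such terms. If all candidates exceeded a quarter of the star,
these bounds would contradict each other: see `three_spokes_aux` for three children and
`four_spokes_aux` for four.

Globally, a vertex lies only on its own path and its parent's, with at most two neighbours on each,
whence degree 4. The union is connected by induction on depth and has at most |V| − 1 edges, so it
is a tree; the weight bound is the sum of the local ones. -/

namespace EuclideanMST

/-! ### Rooted trees and the exchange argument -/

section Graph

variable {V : Type*}

lemma connected_of_forall_adj_reachable {G H : SimpleGraph V} (hG : G.Connected)
    (h : ∀ a b, G.Adj a b → H.Reachable a b) : H.Connected := by
  have := hG.nonempty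
  refine ⟨fun a b => ?_⟩
  obtain ⟨w⟩ := hG.preconnected a b
  induction w with
  | nil => exact .rfl
  | cons hab _ ih => exact (h _ _ hab).trans ih

/-- Connectedness forces at least |V| − 1 edges, so an upper bound through any superset suffices;
overlaps among the edges collected need not be excluded. -/
lemma isTree_of_connected_of_card_le [Fintype V] {G : SimpleGraph V} (hG : G.Connected)
    {s : Finset (Sym2 V)} (hs : G.edgeSet ⊆ s) (hcard : s.card + 1 ≤ Fintype.card V) :
    G.IsTree := by
  rw [SimpleGraph.isTree_iff_connected_and_card]
  refine ⟨hG, le_antisymm ?_ ?_⟩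
  · rw [Nat.card_eq_fintype_card (α := V)]
    have := Nat.card_mono s.finite_toSet hs
    simp only [Finset.coe_sort_coe, Nat.card_eq_fintype_card, Fintype.card_coe] at this
    rw [Nat.card_coe_set_eq] at *
    omega
  · exact hG.card_vert_le_card_edgeSet_add_one

lemma exists_adj_dist_add_one {G : SimpleGraph V} (hG : G.Connected) {r v : V} (h : v ≠ r) :
    ∃ p, G.Adj p v ∧ G.dist r v = G.dist r p + 1 := by
  obtain ⟨w, hw⟩ := hG.exists_walk_length_eq_dist v r
  cases w with
  | nil => exact absurd rfl h
  | @cons _ p _ hvp w' =>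
    refine ⟨p, hvp.symm, ?_⟩
    have h1 := SimpleGraph.dist_le w'
    rw [SimpleGraph.Walk.length_cons, SimpleGraph.dist_comm] at hw
    rw [SimpleGraph.dist_comm] at h1
    have h2 := hG.dist_triangle (u := r) (v := p) (w := v)
    rw [SimpleGraph.dist_eq_one_iff_adj.2 hvp.symm] at h2
    omega

section

variable [MetricSpace V]

lemma edgeLength_nonneg (e : Sym2 V) : 0 ≤ edgeLength e := by
  induction e with | _ a b => exact dist_nonneg

lemma edgeLength_mk (a b : V) : edgeLength s(a, b) = dist a b := rfl

end

variable [Fintype V]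

lemma exists_isLeaf {T : SimpleGraph V} (hT : T.IsTree) : ∃ r : V, IsLeaf T r := by
  classical
  unfold IsLeaf
  rcases subsingleton_or_nontrivial V with h | h
  · obtain ⟨r⟩ := hT.connected.nonempty
    refine ⟨r, ?_⟩
    have := T.degree_lt_card_verts r
    have := Fintype.card_le_one_iff_subsingleton.2 h
    omega
  · obtain ⟨r, hr⟩ := hT.exists_vert_degree_one_of_nontrivial
    exact ⟨r, by convert hr.le⟩

lemma mem_children {T : SimpleGraph V} {r v u : V} :
    u ∈ children T r v ↔ T.Adj v u ∧ T.dist r u = T.dist r v + 1 := by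
  simp [children]

lemma exists_mem_children {T : SimpleGraph V} (hT : T.Connected) {r u : V} (h : u ≠ r) :
    ∃ v, u ∈ children T r v := by
  obtain ⟨p, h1, h2⟩ := exists_adj_dist_add_one hT h
  exact ⟨p, mem_children.2 ⟨h1, h2⟩⟩

open scoped Classical in
lemma card_children_le_degree (T : SimpleGraph V) (r v : V) :
    (children T r v).card ≤ T.degree v := by
  rw [← SimpleGraph.card_neighborFinset_eq_degree]
  exact Finset.card_le_card fun u hu => by simpa using (mem_children.1 hu).1

open scoped Classical in
lemma card_children_lt_degree {T : SimpleGraph V} {r v p : V} (h : v ∈ children T r p) :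
    (children T r v).card < T.degree v := by
  rw [← SimpleGraph.card_neighborFinset_eq_degree]
  refine Finset.card_lt_card ⟨fun u hu => by simpa using (mem_children.1 hu).1, fun hs => ?_⟩
  have h1 := mem_children.1 h
  have h2 := mem_children.1 (hs (by simpa using h1.1.symm : p ∈ T.neighborFinset v))
  omega

/-- The pairs of a vertex and one of its children. -/
noncomputable def parentChildPairs (T : SimpleGraph V) (r : V) : Finset (Σ _ : V, V) :=
  Finset.univ.sigma fun v => children T r v

lemma parentChildPairs_injOn (T : SimpleGraph V) (r : V) :
    Set.InjOn (fun x : Σ _ : V, V => s(x.1, x.2)) (parentChildPairs T r) := by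
  rintro ⟨v, u⟩ h ⟨v', u'⟩ h' he
  simp only [parentChildPairs, Finset.coe_sigma, Set.mem_sigma_iff, Finset.mem_coe,
    mem_children] at h h'
  rcases Sym2.eq_iff.1 he with ⟨h1, h2⟩ | ⟨h1, h2⟩
  · simp only at h1 h2
    rw [h1, h2]
  · simp only at h1 h2
    subst h1 h2
    omega

open scoped Classical in
lemma parentChildPairs_image_subset (T : SimpleGraph V) (r : V) :
    (parentChildPairs T r).image (fun x => s(x.1, x.2)) ⊆ T.edgeFinset := by
  intro e he
  simp only [Finset.mem_image, parentChildPairs, Finset.mem_sigma, mem_children] at he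
  obtain ⟨x, hx, rfl⟩ := he
  simpa using hx.2.1

lemma sum_card_children_add_one_le {T : SimpleGraph V} (hT : T.IsTree) (r : V) :
    ∑ v, (children T r v).card + 1 ≤ Fintype.card V := by
  classical
  have h := Finset.card_le_card (parentChildPairs_image_subset T r)
  rw [Finset.card_image_of_injOn (parentChildPairs_injOn T r), parentChildPairs,
    Finset.card_sigma] at h
  have := hT.card_edgeFinset
  omega

/-- In a rooted tree every vertex is the child of at most one vertex. -/
lemma parent_unique {T : SimpleGraph V} (hT : T.IsTree) {r u v w : V} (hv : u ∈ children T r v)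
    (hw : u ∈ children T r w) : v = w := by
  classical
  by_contra hne
  let A : Finset V := Finset.univ.erase r
  have hA : A.card + 1 = Fintype.card V := Finset.card_erase_add_one (Finset.mem_univ r)
  choose! f hf using fun x (hx : x ∈ A) =>
    exists_mem_children hT.connected (Finset.ne_of_mem_erase hx)
  have hu : u ∈ A := by
    refine Finset.mem_erase.2 ⟨?_, Finset.mem_univ u⟩
    rintro rfl
    have := (mem_children.1 hv).2
    simp at this
  -- A second parent `q` of `u` adds a pair to the |V| − 1 pairs `⟨f x, x⟩`, one more than the tree
  -- has edges.
  obtain ⟨q, hq, hqf⟩ : ∃ q, u ∈ children T r q ∧ q ≠ f u := by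
    by_cases h : v = f u
    · exact ⟨w, hw, fun h' => hne (h.trans h'.symm)⟩
    · exact ⟨v, hv, h⟩
  let g : V → Σ _ : V, V := fun x => ⟨f x, x⟩
  have hg : (A.image g).card = A.card := Finset.card_image_of_injective _ fun x y h => by
    simp only [g, Sigma.mk.injEq, heq_eq_eq] at h; exact h.2
  have hsub : insert (⟨q, u⟩ : Σ _ : V, V) (A.image g) ⊆ parentChildPairs T r := by
    intro x hx
    rcases Finset.mem_insert.1 hx with rfl | hx
    · exact Finset.mem_sigma.2 ⟨Finset.mem_univ _, hq⟩
    · obtain ⟨y, hy, rfl⟩ := Finset.mem_image.1 hx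
      exact Finset.mem_sigma.2 ⟨Finset.mem_univ _, hf y hy⟩
  have h1 := Finset.card_le_card hsub
  rw [Finset.card_insert_of_notMem, hg, parentChildPairs, Finset.card_sigma] at h1
  · have := sum_card_children_add_one_le hT r
    omega
  · intro hm
    obtain ⟨y, _, hy⟩ := Finset.mem_image.1 hm
    simp only [g, Sigma.mk.injEq, heq_eq_eq] at hy
    obtain ⟨h2, rfl⟩ := hy
    exact hqf h2.symm

variable [MetricSpace V]

open scoped Classical in
lemma weight_le_of_edgeSet_subset {G : SimpleGraph V} {s : Finset (Sym2 V)}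
    (hs : G.edgeSet ⊆ s) : weight G ≤ ∑ e ∈ s, edgeLength e :=
  Finset.sum_le_sum_of_subset_of_nonneg (fun _ he => hs (SimpleGraph.mem_edgeFinset.1 he))
    fun _ _ _ => edgeLength_nonneg _

open scoped Classical in
/-- Two edges of a minimum spanning tree with a common endpoint are at most as long as the third
side of the triangle that they span. -/
lemma IsMST.dist_le {T : SimpleGraph V} (hT : IsMST T) {v a b : V} (ha : T.Adj v a)
    (hb : T.Adj v b) (hab : a ≠ b) : dist v a ≤ dist a b := by
  let s : Finset (Sym2 V) := insert s(a, b) (T.edgeFinset.erase s(v, a))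
  let H : SimpleGraph V := SimpleGraph.fromEdgeSet s
  have hmem : s(v, a) ∈ T.edgeFinset := SimpleGraph.mem_edgeFinset.2 ha
  have hHs : H.edgeSet ⊆ s := by
    rw [SimpleGraph.edgeSet_fromEdgeSet]; exact Set.sdiff_subset
  have hHab : H.Adj b a := by
    rw [SimpleGraph.fromEdgeSet_adj]
    exact ⟨by simp [s, Sym2.eq_swap], hab.symm⟩
  have hHne : ∀ x y, T.Adj x y → s(x, y) ≠ s(v, a) → H.Adj x y := fun x y h hne => by
    rw [SimpleGraph.fromEdgeSet_adj]
    exact ⟨by simp [s, h, hne], h.ne⟩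
  have hva : H.Reachable v a := by
    refine (hHne v b hb ?_).reachable.trans hHab.reachable
    rw [Ne, Sym2.congr_right]
    exact hab.symm
  have hconn : H.Connected := by
    refine connected_of_forall_adj_reachable hT.1.connected fun x y h => ?_
    by_cases hxy : s(x, y) = s(v, a)
    · rcases Sym2.eq_iff.1 hxy with ⟨rfl, rfl⟩ | ⟨rfl, rfl⟩
      exacts [hva, hva.symm]
    · exact (hHne x y h hxy).reachable
  have hcard : s.card + 1 ≤ Fintype.card V := by
    have h1 := Finset.card_insert_le s(a, b) (T.edgeFinset.erase s(v, a))
    rw [Finset.card_erase_add_one hmem] at h1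
    have := hT.1.card_edgeFinset
    simp only [s]
    omega
  have hw := (hT.2 H (isTree_of_connected_of_card_le hconn hHs hcard)).trans
    (weight_le_of_edgeSet_subset hHs)
  -- An inequality, since inserting an edge that is already present adds nothing.
  have h2 : ∑ e ∈ s, edgeLength e ≤
      edgeLength s(a, b) + ∑ e ∈ T.edgeFinset.erase s(v, a), edgeLength e := by
    by_cases hm : s(a, b) ∈ T.edgeFinset.erase s(v, a)
    · simp only [s, Finset.insert_eq_of_mem hm]
      linarith [edgeLength_nonneg s(a, b)]
    · simp only [s, Finset.sum_insert hm, le_refl]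
  have h3 := Finset.add_sum_erase T.edgeFinset edgeLength hmem
  rw [weight] at hw
  simp only [edgeLength_mk] at h2 h3
  linarith

lemma sum_dist_children_le_weight (T : SimpleGraph V) (r : V) :
    ∑ v, ∑ u ∈ children T r v, dist v u ≤ weight T := by
  classical
  have h := Finset.sum_le_sum_of_subset_of_nonneg (parentChildPairs_image_subset T r)
    (fun e _ _ => edgeLength_nonneg e)
  rw [Finset.sum_image (parentChildPairs_injOn T r), parentChildPairs, Finset.sum_sigma] at h
  exact h

end Graph

/-! ### Paths as lists, and the union of the paths -/

section Paths

variable {V : Type*}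

lemma pathGraph_adj {l : List V} {a b : V} :
    (pathGraph l).Adj a b ↔ a ≠ b ∧ ([a, b] <:+: l ∨ [b, a] <:+: l) := by
  simp [pathGraph]

lemma pair_infix_cons_cons {a b x y : V} {l : List V} :
    [x, y] <:+: a :: b :: l ↔ (x = a ∧ y = b) ∨ [x, y] <:+: b :: l := by
  rw [List.infix_cons_iff, List.cons_prefix_cons, List.cons_prefix_cons]
  simp

/-- The pairs of consecutive elements of a list. -/
def pathEdges : List V → List (Sym2 V)
  | [] => []
  | [_] => []
  | a :: b :: l => s(a, b) :: pathEdges (b :: l)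

lemma length_pathEdges : ∀ l : List V, (pathEdges l).length = l.length - 1
  | [] => rfl
  | [_] => rfl
  | a :: b :: l => by simp [pathEdges, length_pathEdges (b :: l)]

lemma mem_pathEdges {x y : V} : ∀ {l : List V},
    s(x, y) ∈ pathEdges l ↔ [x, y] <:+: l ∨ [y, x] <:+: l
  | [] => by simp [pathEdges]
  | [a] => by
    simp only [pathEdges, List.not_mem_nil, false_iff, not_or]
    constructor <;> exact fun h => by simpa using h.length_le
  | a :: b :: l => by
    rw [pathEdges, List.mem_cons, mem_pathEdges (l := b :: l), pair_infix_cons_cons,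
      pair_infix_cons_cons, Sym2.eq_iff]
    tauto

lemma edgeSet_pathGraph_subset (l : List V) : ∀ e ∈ (pathGraph l).edgeSet, e ∈ pathEdges l := by
  intro e
  induction e with
  | _ x y =>
    rw [SimpleGraph.mem_edgeSet, pathGraph_adj, mem_pathEdges]
    exact fun h => h.2

lemma mem_of_pathGraph_adj {l : List V} {a b : V} (h : (pathGraph l).Adj a b) : a ∈ l := by
  rcases (pathGraph_adj.1 h).2 with h | h <;> exact h.subset (by simp)

lemma reachable_pathGraph {x y : V} {l : List V} (hx : x ∈ l) (hy : y ∈ l) :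
    (pathGraph l).Reachable x y := by
  suffices h : ∀ (l : List V) (a : V), ∀ x ∈ a :: l, (pathGraph (a :: l)).Reachable a x by
    cases l with
    | nil => simp at hx
    | cons a l => exact (h l a x hx).symm.trans (h l a y hy)
  intro l
  induction l with
  | nil =>
    intro a x hx
    rw [List.mem_singleton.1 hx]
  | cons b l ih =>
    intro a x hx
    rcases List.mem_cons.1 hx with rfl | hx
    · exact .rfl
    have hab : (pathGraph (a :: b :: l)).Reachable a b := by
      by_cases h : a = b
      · rw [h]
      · exact SimpleGraph.Adj.reachable
          (pathGraph_adj.2 ⟨h, .inl (pair_infix_cons_cons.2 (.inl ⟨rfl, rfl⟩))⟩)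
    refine hab.trans ((ih b x hx).mono fun u v h => ?_)
    rw [pathGraph_adj] at h ⊢
    exact ⟨h.1, h.2.imp List.infix_cons List.infix_cons⟩

lemma eq_of_pair_infix_of_pair_infix {x y z : V} : ∀ {l : List V}, l.Nodup →
    [x, y] <:+: l → [x, z] <:+: l → y = z
  | [], _, h, _ => by simp at h
  | [a], _, h, _ => by simpa using h.length_le
  | a :: b :: l, hl, h, h' => by
    rw [pair_infix_cons_cons] at h h'
    have hl' := List.nodup_cons.1 hl
    rcases h with ⟨rfl, rfl⟩ | h <;> rcases h' with ⟨h1, h2⟩ | h'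
    · exact h2.symm
    · exact absurd (h'.subset (by simp)) hl'.1
    · subst h1
      exact absurd (h.subset (by simp)) hl'.1
    · exact eq_of_pair_infix_of_pair_infix hl'.2 h h'

lemma exists_pathGraph_neighbors_subset {l : List V} (hl : l.Nodup) (x : V) :
    ∃ s : Finset V, s.card ≤ 2 ∧ ∀ y, (pathGraph l).Adj x y → y ∈ s := by
  classical
  have h1 : ∃ a, ∀ y, [x, y] <:+: l → y = a := by
    by_cases h : ∃ a, [x, a] <:+: l
    · obtain ⟨a, ha⟩ := h
      exact ⟨a, fun y hy => eq_of_pair_infix_of_pair_infix hl hy ha⟩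
    -- Without a successor the condition is vacuous and `x` is only a default.
    · exact ⟨x, fun y hy => absurd ⟨y, hy⟩ h⟩
  have h2 : ∃ a, ∀ y, [y, x] <:+: l → y = a := by
    have key : ∀ y, [y, x] <:+: l → [x, y] <:+: l.reverse := fun y hy => by
      simpa using List.reverse_infix.2 hy
    by_cases h : ∃ a, [a, x] <:+: l
    · obtain ⟨a, ha⟩ := h
      exact ⟨a, fun y hy => eq_of_pair_infix_of_pair_infix (List.nodup_reverse.2 hl)
        (key y hy) (key a ha)⟩
    · exact ⟨x, fun y hy => absurd ⟨y, hy⟩ h⟩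
  obtain ⟨a, ha⟩ := h1
  obtain ⟨b, hb⟩ := h2
  refine ⟨{a, b}, Finset.card_le_two, fun y hy => ?_⟩
  rw [Finset.mem_insert, Finset.mem_singleton]
  exact (pathGraph_adj.1 hy).2.imp (ha y) (hb y)

lemma unionOfPaths_adj {P : V → List V} {a b : V} :
    (unionOfPaths P).Adj a b ↔ ∃ v, (pathGraph (P v)).Adj a b := by
  simp [unionOfPaths]

open scoped Classical in
lemma IsPathThrough.length_eq {s : Finset V} {l : List V} (h : IsPathThrough (s : Set V) l) :
    l.length = s.card := by
  rw [← List.toFinset_card_of_nodup h.1]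
  congr 1
  ext x
  simpa using h.2 x

section

variable [MetricSpace V]

open scoped Classical in
lemma sum_edgeLength_pathEdges (l : List V) :
    ∑ e ∈ (pathEdges l).toFinset, edgeLength e ≤ pathWeight l := by
  have h1 : ∀ L : List (Sym2 V), ∑ e ∈ L.toFinset, edgeLength e ≤ (L.map edgeLength).sum := by
    intro L
    induction L with
    | nil => simp
    | cons e L ih =>
      rw [List.toFinset_cons, List.map_cons, List.sum_cons]
      by_cases h : e ∈ L.toFinset
      · rw [Finset.insert_eq_of_mem h]
        linarith [edgeLength_nonneg e]
      · rw [Finset.sum_insert h]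
        linarith
  have h2 : ∀ l : List V, ((pathEdges l).map edgeLength).sum = pathWeight l := by
    intro l
    induction l with
    | nil => rfl
    | cons a l ih =>
      cases l with
      | nil => rfl
      | cons b l =>
        rw [pathEdges, List.map_cons, List.sum_cons, ih, pathWeight, edgeLength_mk]
  exact (h1 _).trans (h2 l).le

end

variable [Fintype V]

lemma notMem_children_self (T : SimpleGraph V) (r v : V) : v ∉ children T r v := fun h =>
  (mem_children.1 h).1.ne rfl

open scoped Classical in
lemma edgeSet_unionOfPaths_subset (P : V → List V) :
    (unionOfPaths P).edgeSet ⊆ Finset.univ.biUnion fun v => (pathEdges (P v)).toFinset := by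
  intro e
  induction e with
  | _ x y =>
    intro h
    obtain ⟨v, hv⟩ := unionOfPaths_adj.1 (SimpleGraph.mem_edgeSet _ |>.1 h)
    simp only [Finset.coe_biUnion, Set.mem_iUnion, Finset.mem_coe, List.mem_toFinset]
    exact ⟨v, Finset.mem_univ v, edgeSet_pathGraph_subset _ _ hv⟩

variable [MetricSpace V]

lemma exists_isShortestPathThrough (s : Set V) : ∃ l, IsShortestPathThrough s l := by
  classical
  have hfin : {l : List V | IsPathThrough s l}.Finite :=
    (List.finite_length_le V (Fintype.card V)).subset fun l hl => hl.1.length_le_card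
  obtain ⟨l, hl, hmin⟩ := Set.exists_min_image _ pathWeight hfin
    ⟨s.toFinset.toList, Finset.nodup_toList _, by simp⟩
  exact ⟨l, hl, hmin⟩

variable {T : SimpleGraph V} {r : V} {P : V → List V}

lemma length_eq_card_children (hP : IsShortestPathFamily T r P) (v : V) :
    (P v).length = (children T r v).card + 1 := by
  classical
  have h := (hP v).1
  rw [← Finset.coe_insert] at h
  rw [h.length_eq, Finset.card_insert_of_notMem (notMem_children_self T r v)]

lemma unionOfPaths_connected (hT : T.Connected) (hP : IsShortestPathFamily T r P) :
    (unionOfPaths P).Connected := by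
  have := hT.nonempty
  have key : ∀ n v, T.dist r v = n → (unionOfPaths P).Reachable r v := by
    intro n
    induction n with
    | zero =>
      intro v hv
      rw [hT.dist_eq_zero_iff.1 hv]
    | succ n ih =>
      intro v hv
      have hne : v ≠ r := by
        rintro rfl
        simp at hv
      obtain ⟨p, hp⟩ := exists_mem_children hT hne
      have h1 := (mem_children.1 hp).2
      refine (ih p (by omega)).trans ?_
      refine (reachable_pathGraph (l := P p) (((hP p).1.2 p).2 (by simp))
        (((hP p).1.2 v).2 (by simp [hp]))).mono ?_
      exact le_iSup (fun v => pathGraph (P v)) p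
  exact ⟨fun a b => (key _ a rfl).symm.trans (key _ b rfl)⟩

lemma unionOfPaths_isTree (hT : T.IsTree) (hP : IsShortestPathFamily T r P) :
    (unionOfPaths P).IsTree := by
  classical
  refine isTree_of_connected_of_card_le (unionOfPaths_connected hT.connected hP)
    (edgeSet_unionOfPaths_subset P) ?_
  -- The path of a vertex with k children has k edges, so the union has no more edges than there are
  -- parent-child pairs.
  refine le_trans (Nat.add_le_add_right (Finset.card_biUnion_le.trans
    (Finset.sum_le_sum fun v _ => ?_)) 1) (sum_card_children_add_one_le hT r)
  refine (List.toFinset_card_le _).trans ?_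
  rw [length_pathEdges, length_eq_card_children hP, Nat.add_sub_cancel]

lemma weight_unionOfPaths_le (P : V → List V) :
    weight (unionOfPaths P) ≤ ∑ v, pathWeight (P v) := by
  classical
  refine (weight_le_of_edgeSet_subset (edgeSet_unionOfPaths_subset P)).trans ?_
  have h : ∀ s : Finset V, ∑ e ∈ s.biUnion (fun v => (pathEdges (P v)).toFinset), edgeLength e ≤
      ∑ v ∈ s, ∑ e ∈ (pathEdges (P v)).toFinset, edgeLength e := by
    intro s
    induction s using Finset.induction_on with
    | empty => simp
    | insert a s ha ih =>
      rw [Finset.biUnion_insert, Finset.sum_insert ha]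
      have h1 := Finset.sum_union_inter (s₁ := (pathEdges (P a)).toFinset)
        (s₂ := s.biUnion fun v => (pathEdges (P v)).toFinset) (f := edgeLength)
      have h2 : 0 ≤ ∑ e ∈ (pathEdges (P a)).toFinset ∩
          s.biUnion (fun v => (pathEdges (P v)).toFinset), edgeLength e :=
        Finset.sum_nonneg fun e _ => edgeLength_nonneg e
      linarith
  exact (h _).trans (Finset.sum_le_sum fun v _ => sum_edgeLength_pathEdges (P v))

lemma unionOfPaths_degreeAtMost (hT : T.IsTree) (hP : IsShortestPathFamily T r P) :
    DegreeAtMost (unionOfPaths P) 4 := by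
  classical
  intro u
  obtain ⟨s, hs, hs'⟩ := exists_pathGraph_neighbors_subset (hP u).1.1 u
  obtain ⟨t, ht, ht'⟩ : ∃ t : Finset V, t.card ≤ 2 ∧ ∀ v, u ∈ children T r v →
      ∀ y, (pathGraph (P v)).Adj u y → y ∈ t := by
    by_cases h : ∃ v, u ∈ children T r v
    · obtain ⟨p, hp⟩ := h
      obtain ⟨t, ht, ht'⟩ := exists_pathGraph_neighbors_subset (hP p).1.1 u
      refine ⟨t, ht, fun v hv => ?_⟩
      rw [parent_unique hT hv hp]
      exact ht'
    · exact ⟨∅, by simp, fun v hv => absurd ⟨v, hv⟩ h⟩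
  rw [← SimpleGraph.card_neighborFinset_eq_degree]
  refine (Finset.card_le_card (t := s ∪ t) fun y hy => ?_).trans
    ((Finset.card_union_le s t).trans (by omega))
  rw [SimpleGraph.mem_neighborFinset, unionOfPaths_adj] at hy
  obtain ⟨v, hv⟩ := hy
  have hu := ((hP v).1.2 u).1 (mem_of_pathGraph_adj hv)
  rcases hu with rfl | hu
  · exact Finset.mem_union_left _ (hs' y hv)
  · exact Finset.mem_union_right _ (ht' v hu y hv)

end Paths

/-! ### Bounds for sines of half-angles -/

section Trigonometry

open Real

lemma pi_div_three_le_of_cos_le_half {x : ℝ} (h0 : 0 ≤ x) (h : cos x ≤ 1 / 2) : π / 3 ≤ x := by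
  by_contra! hx
  have := cos_lt_cos_of_nonneg_of_le_pi h0 (by linarith [pi_pos]) hx
  rw [cos_pi_div_three] at this
  linarith

lemma le_five_pi_div_three_of_cos_le_half {x : ℝ} (h0 : x ≤ 2 * π) (h : cos x ≤ 1 / 2) :
    x ≤ 5 * π / 3 := by
  have := pi_div_three_le_of_cos_le_half (x := 2 * π - x) (by linarith)
    (by rwa [cos_two_pi_sub])
  linarith

lemma sin_sq_add_sin_sq_le_one {x y : ℝ} (hx : 0 ≤ x) (hy : 0 ≤ y) (h : x + y ≤ π / 2) :
    sin x ^ 2 + sin y ^ 2 ≤ 1 := by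
  have h1 : sin y ≤ cos x := by
    rw [← sin_pi_div_two_sub]
    exact sin_le_sin_of_le_of_le_pi_div_two (by linarith [pi_pos]) (by linarith) (by linarith)
  have h2 : 0 ≤ sin y := sin_nonneg_of_nonneg_of_le_pi hy (by linarith [pi_pos])
  nlinarith [sin_sq_add_cos_sq x]

/-- This rational stand-in for √3 is what leads to the constants 7/8 and 7/4 below, and to 3/4 and
3/2 in `four_spokes_aux`. -/
lemma sqrt_three_le : √3 ≤ 7 / 4 := by
  rw [sqrt_le_left (by norm_num)]; norm_num

lemma sin_le_seven_eighths {x : ℝ} (h0 : 0 ≤ x) (h : x ≤ π / 3) : sin x ≤ 7 / 8 := by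
  have := sin_le_sin_of_le_of_le_pi_div_two (by linarith [pi_pos]) (by linarith [pi_pos]) h
  rw [sin_pi_div_three] at this
  linarith [sqrt_three_le]

lemma sin_add_sin_le_seven_quarters {x y : ℝ} (hx : 0 ≤ x) (hy : 0 ≤ y)
    (h : x + y ≤ 2 * π / 3) : sin x + sin y ≤ 7 / 4 := by
  have e : sin x + sin y = 2 * (sin ((x + y) / 2) * cos ((x - y) / 2)) := by
    have h1 := sin_add ((x + y) / 2) ((x - y) / 2)
    have h2 := sin_sub ((x + y) / 2) ((x - y) / 2)
    rw [show (x + y) / 2 + (x - y) / 2 = x by ring] at h1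
    rw [show (x + y) / 2 - (x - y) / 2 = y by ring] at h2
    linarith
  have h1 := sin_le_seven_eighths (x := (x + y) / 2) (by linarith) (by linarith)
  have h2 : 0 ≤ sin ((x + y) / 2) :=
    sin_nonneg_of_nonneg_of_le_pi (by linarith) (by linarith [pi_pos])
  nlinarith [cos_le_one ((x - y) / 2)]

end Trigonometry

/-! ### Inequalities between spoke lengths and chords -/

section RealInequalities

/-- Call excess the weight of a path minus the sum of the spokes, and let m = min(d₁, d₂). The path
of `hA` has excess at most m f₁₂ + min(d₃, d₄) f₃₄; if this is above a quarter of the sum, then d₃,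
d₄ ≤ m by `key`. Now `hB` has excess at most d₄ f₃₄ + d₃ f₂₃, small enough if d₄ ≤ d₃, and `hC` at
most d₃ f₃₄ + d₄ f₂₄, which together with `hA` settles d₃ ≤ d₄. -/
lemma four_spokes_aux {d₁ d₂ d₃ d₄ D₁₂ D₃₄ D₂₃ D₂₄ f₁₂ f₃₄ f₂₃ f₂₄ B : ℝ}
    (p₁ : 0 < d₁) (p₂ : 0 < d₂) (p₃ : 0 < d₃) (p₄ : 0 < d₄)
    (h₁₂ : D₁₂ + min d₁ d₂ ≤ d₁ + d₂ + min d₁ d₂ * f₁₂)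
    (h₃₄ : D₃₄ + min d₃ d₄ ≤ d₃ + d₄ + min d₃ d₄ * f₃₄)
    (h₂₃ : D₂₃ + min d₂ d₃ ≤ d₂ + d₃ + min d₂ d₃ * f₂₃)
    (h₂₄ : D₂₄ + min d₂ d₄ ≤ d₂ + d₄ + min d₂ d₄ * f₂₄)
    (k : 1 / 2 < f₁₂) (k₁₂ : f₁₂ ≤ 3 / 4) (k₁ : (f₁₂ + 1) ^ 2 + (f₃₄ + 1) ^ 2 ≤ 4)
    (k₂ : (f₁₂ + 1) ^ 2 + (f₂₃ + 1) ^ 2 ≤ 4) (k₃ : f₁₂ + f₂₄ ≤ 3 / 2) (k₂₄ : f₂₄ ≤ 1)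
    (hA : B ≤ D₁₂ + D₃₄ + min d₁ d₂ + min d₃ d₄)
    (hB : B ≤ d₁ + d₄ + D₃₄ + D₂₃) (hC : B ≤ d₁ + d₃ + D₃₄ + D₂₄) :
    B ≤ 5 / 4 * (d₁ + d₂ + d₃ + d₄) := by
  by_contra! hlt
  have m1 := min_le_left d₁ d₂
  have m2 := min_le_right d₁ d₂
  have mp : 0 < min d₁ d₂ := lt_min p₁ p₂
  generalize min d₁ d₂ = m at *
  have k₃₄ : f₃₄ ≤ 1 / 3 := by nlinarith
  have k₂₃ : f₂₃ ≤ 1 / 3 := by nlinarith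
  have ks : f₁₂ + f₃₄ ≤ 1 := by nlinarith [sq_nonneg (f₁₂ - f₃₄)]
  have key : ∀ x y : ℝ, 0 < x → x ≤ y →
      (d₁ + d₂ + x + y) / 4 < m * f₁₂ + x * f₃₄ → y ≤ m := by
    intro x y hx hxy h
    by_contra! hm
    have e1 : m * (f₁₂ - 1 / 2) ≤ y * (f₁₂ - 1 / 2) := by gcongr
    rcases le_total f₃₄ (1 / 4) with h4 | h4
    · nlinarith
    · have e2 : x * (f₃₄ - 1 / 4) ≤ y * (f₃₄ - 1 / 4) := by gcongr
      nlinarith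
  rcases le_total d₄ d₃ with h | h
  · rw [min_eq_right h] at *
    have h3 : d₃ ≤ m := key d₄ d₃ p₄ h (by linarith)
    rw [min_eq_right (h3.trans m2)] at *
    nlinarith
  · rw [min_eq_left h] at *
    have hA' : (d₁ + d₂ + d₃ + d₄) / 4 < m * f₁₂ + d₃ * f₃₄ := by linarith
    have h4 : d₄ ≤ m := key d₃ d₄ p₃ h hA'
    rw [min_eq_right (h4.trans m2)] at *
    have hC' : (d₁ + d₂ + d₃ + d₄) / 4 < d₃ * f₃₄ + d₄ * f₂₄ := by linarith
    rcases le_total f₃₄ (1 / 4) with q | q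
    · have e : d₃ * f₃₄ ≤ d₃ * (1 / 4) := by gcongr
      have e1 : m / 2 + d₄ / 4 < m * f₁₂ := by linarith
      have e2 : m / 2 + d₄ / 4 < d₄ * (3 / 2 - f₁₂) := by
        have : d₄ * f₂₄ ≤ d₄ * (3 / 2 - f₁₂) := by gcongr; linarith
        linarith
      have e3 := mul_lt_mul_of_pos_left e1 p₄
      have e4 := mul_lt_mul_of_pos_left e2 mp
      -- Adding `e3` and `e4` eliminates f₁₂ and leaves (m − d₄)(2m − d₄) < 0.
      nlinarith [mul_nonneg (sub_nonneg.2 h4) (show (0 : ℝ) ≤ 2 * m - d₄ by linarith)]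
    -- From `k₁`: (f₁₂ + 1)² ≤ 4 − (5/4)² = 39/16.
    · have e0 : f₁₂ ≤ 57 / 100 := by nlinarith
      have e1 : m * f₁₂ ≤ m * (57 / 100) := by gcongr
      have e2 : d₃ * f₃₄ ≤ d₃ * (1 / 3) := by gcongr
      have e3 : d₄ * f₂₄ ≤ d₄ * 1 := by gcongr
      linarith

/-- With m = min(d₁, d₂), suppose all three excesses are above (2m + d₃)/4. Weighting the first by
d₃ and the other two by m makes the f's add up, giving (2m + d₃)² < 9 m d₃, that is (m − d₃)(4m −
d₃) < 0. -/
lemma three_spokes_aux {d₁ d₂ d₃ f₁₂ f₁₃ f₂₃ B : ℝ} (p₃ : 0 < d₃) (h₁ : d₃ ≤ d₁) (h₂ : d₃ ≤ d₂)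
    (k : f₁₂ + f₁₃ + f₂₃ ≤ 9 / 4)
    (h₁₂ : B ≤ d₁ + d₂ + d₃ + min d₁ d₂ * f₁₂) (h₁₃ : B ≤ d₁ + d₂ + d₃ + d₃ * f₁₃)
    (h₂₃ : B ≤ d₁ + d₂ + d₃ + d₃ * f₂₃) :
    B ≤ 5 / 4 * (d₁ + d₂ + d₃) := by
  by_contra! hlt
  have m1 := min_le_left d₁ d₂
  have m2 := min_le_right d₁ d₂
  have m3 : d₃ ≤ min d₁ d₂ := le_min h₁ h₂
  generalize min d₁ d₂ = m at *
  have mp : 0 < m := by linarith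
  have e1 : (2 * m + d₃) / 4 < m * f₁₂ := by linarith
  have e2 : (2 * m + d₃) / 4 < d₃ * f₁₃ := by linarith
  have e3 : (2 * m + d₃) / 4 < d₃ * f₂₃ := by linarith
  have g1 := mul_lt_mul_of_pos_left e1 p₃
  have g2 := mul_lt_mul_of_pos_left (add_lt_add e2 e3) mp
  have g3 := mul_le_mul_of_nonneg_left k (mul_pos mp p₃).le
  nlinarith [mul_nonneg (sub_nonneg.2 m3) (show (0 : ℝ) ≤ 4 * m - d₃ by linarith)]

lemma three_spokes {d₁ d₂ d₃ D₁₂ D₁₃ D₂₃ f₁₂ f₁₃ f₂₃ B : ℝ}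
    (p₁ : 0 < d₁) (p₂ : 0 < d₂) (p₃ : 0 < d₃) (k : f₁₂ + f₁₃ + f₂₃ ≤ 9 / 4)
    (h₁₂ : D₁₂ + min d₁ d₂ ≤ d₁ + d₂ + min d₁ d₂ * f₁₂)
    (h₁₃ : D₁₃ + min d₁ d₃ ≤ d₁ + d₃ + min d₁ d₃ * f₁₃)
    (h₂₃ : D₂₃ + min d₂ d₃ ≤ d₂ + d₃ + min d₂ d₃ * f₂₃)
    (hA : B ≤ D₁₂ + min d₁ d₂ + d₃) (hB : B ≤ D₁₃ + min d₁ d₃ + d₂)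
    (hC : B ≤ D₂₃ + min d₂ d₃ + d₁) :
    B ≤ 5 / 4 * (d₁ + d₂ + d₃) := by
  have a := hA.trans (by linarith : _ ≤ d₁ + d₂ + d₃ + min d₁ d₂ * f₁₂)
  have b := hB.trans (by linarith : _ ≤ d₁ + d₂ + d₃ + min d₁ d₃ * f₁₃)
  have c := hC.trans (by linarith : _ ≤ d₁ + d₂ + d₃ + min d₂ d₃ * f₂₃)
  by_cases h3 : d₃ ≤ d₁ ∧ d₃ ≤ d₂
  · rw [min_eq_right h3.1] at b
    rw [min_eq_right h3.2] at c
    exact three_spokes_aux p₃ h3.1 h3.2 k a b c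
  by_cases h2 : d₂ ≤ d₁ ∧ d₂ ≤ d₃
  · rw [min_eq_right h2.1] at a
    rw [min_eq_left h2.2] at c
    have := three_spokes_aux (B := B) (f₁₂ := f₁₃) (f₁₃ := f₁₂) p₂ h2.1 h2.2 (by linarith)
      (by linarith) (by linarith) (by linarith : B ≤ _ + d₂ * f₂₃)
    linarith
  · have h12 : d₁ ≤ d₂ := by grind
    have h13 : d₁ ≤ d₃ := by grind
    rw [min_eq_left h12] at a
    rw [min_eq_left h13] at b
    have := three_spokes_aux (B := B) (f₁₂ := f₂₃) (f₁₃ := f₁₂) p₁ h12 h13 (by linarith)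
      (by linarith) (by linarith) (by linarith : B ≤ _ + d₁ * f₁₃)
    linarith

/-- This is the triangle inequality via the point of the longer spoke at the distance of the shorter
one; `s` is the chord of the unit circle for the angle with cosine `c`. -/
lemma chord_add_min_le {D d e s c : ℝ} (hd : 0 ≤ d) (he : 0 ≤ e) (hs : 0 ≤ s) (hs2 : s ≤ 2)
    (hsc : s ^ 2 = 2 - 2 * c) (hD : D ^ 2 = d ^ 2 + e ^ 2 - 2 * d * e * c) :
    D + min d e ≤ d + e + min d e * (s - 1) := by
  have aux : ∀ x y : ℝ, 0 ≤ x → x ≤ y → D ^ 2 = x ^ 2 + y ^ 2 - 2 * x * y * c →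
      D ≤ y - x + x * s := by
    intro x y hx hxy h
    have h0 : 0 ≤ y - x + x * s := add_nonneg (sub_nonneg.2 hxy) (mul_nonneg hx hs)
    refine le_of_sq_le_sq ?_ h0
    have : 0 ≤ x * (y - x) * (s * (2 - s)) :=
      mul_nonneg (mul_nonneg hx (by linarith)) (mul_nonneg hs (by linarith))
    have hc : c = 1 - s ^ 2 / 2 := by linarith
    rw [h, hc]
    nlinarith
  rcases le_total d e with h | h
  · rw [min_eq_left h]
    linarith [aux d e hd h hD]
  · rw [min_eq_right h]
    linarith [aux e d he h (by linarith)]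

end RealInequalities

/-! ### Polar angles around a vertex -/

section Angles

open Real

/-- Polar angles, in the interval `(0, 2π]`, around a point `v` of the plane, measured from the ray
towards `p`. -/
lemma exists_angle_around {v p : EuclideanSpace ℝ (Fin 2)} (hvp : v ≠ p) :
    ∃ θ : EuclideanSpace ℝ (Fin 2) → ℝ, (∀ x, 0 < θ x ∧ θ x ≤ 2 * π) ∧ θ p = 2 * π ∧
      ∀ x y, dist x y ^ 2 = dist v x ^ 2 + dist v y ^ 2 -
        2 * dist v x * dist v y * cos (θ x - θ y) := by
  let ψ := Complex.orthonormalBasisOneI.repr.symm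
  let z : EuclideanSpace ℝ (Fin 2) → ℂ := fun x => ψ (x - v)
  have hz : ∀ x, ‖z x‖ = dist v x := fun x => by
    simp only [z, LinearIsometryEquiv.norm_map, dist_eq_norm, norm_sub_rev]
  have hzz : ∀ x y, dist x y = ‖z x - z y‖ := fun x y => by
    simp only [z, ← map_sub, LinearIsometryEquiv.norm_map, dist_eq_norm, sub_sub_sub_cancel_right]
  have hw : z p ≠ 0 := by
    rw [← norm_ne_zero_iff, hz]; exact dist_ne_zero.2 hvp
  -- The sign and the shift by π move the range of `arg` from (−π, π] to (0, 2π] and cut the circle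
  -- at `p`.
  refine ⟨fun x => Complex.arg (-(z x / z p)) + π, fun x => ?_, ?_, fun x y => ?_⟩
  · have := Complex.neg_pi_lt_arg (-(z x / z p))
    have := Complex.arg_le_pi (-(z x / z p))
    constructor <;> linarith
  · simp only [div_self hw, Complex.arg_neg_one]; ring
  · rw [← hz x, ← hz y, hzz x y, add_sub_add_right_eq_sub]
    have e : ∀ x, z x = z p * -(-(z x / z p)) := fun x => by field_simp
    have hx := e x
    have hy := e y
    generalize -(z x / z p) = a at *
    generalize -(z y / z p) = b at *
    rw [hx, hy, ← mul_sub, norm_mul, norm_mul, norm_mul, norm_neg, norm_neg, cos_sub]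
    have key : ‖-a - -b‖ ^ 2 = ‖a‖ ^ 2 + ‖b‖ ^ 2 - 2 * ‖a‖ * ‖b‖ *
        (cos a.arg * cos b.arg + sin a.arg * sin b.arg) := by
      have e1 := Complex.norm_mul_cos_arg a
      have e2 := Complex.norm_mul_cos_arg b
      have e3 := Complex.norm_mul_sin_arg a
      have e4 := Complex.norm_mul_sin_arg b
      have : 2 * ‖a‖ * ‖b‖ * (cos a.arg * cos b.arg + sin a.arg * sin b.arg) =
          2 * (a.re * b.re + a.im * b.im) := by rw [← e1, ← e2, ← e3, ← e4]; ring
      rw [this, Complex.sq_norm, Complex.sq_norm, Complex.sq_norm]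
      simp only [Complex.normSq_apply, Complex.sub_re, Complex.neg_re, Complex.sub_im,
        Complex.neg_im]
      ring
    rw [mul_pow, key]
    ring

variable {V : Type*} [MetricSpace V] {v : V} {θ : V → ℝ}

lemma cos_sub_le_half
    (hθ : ∀ x y, dist x y ^ 2 = dist v x ^ 2 + dist v y ^ 2 -
        2 * dist v x * dist v y * cos (θ x - θ y)) {a b : V} (ha : v ≠ a) (hb : v ≠ b)
    (h1 : dist v a ≤ dist a b) (h2 : dist v b ≤ dist a b) : cos (θ a - θ b) ≤ 1 / 2 := by
  have h := hθ a b
  have pa : 0 < dist v a := dist_pos.2 ha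
  have pb : 0 < dist v b := dist_pos.2 hb
  by_contra! hc
  have h3 := mul_lt_mul_of_pos_left hc (mul_pos pa pb)
  rcases le_total (dist v a) (dist v b) with q | q <;> nlinarith

lemma dist_add_min_le
    (hθ : ∀ x y, dist x y ^ 2 = dist v x ^ 2 + dist v y ^ 2 -
        2 * dist v x * dist v y * cos (θ x - θ y)) (a b : V) :
    dist a b + min (dist v a) (dist v b) ≤ dist v a + dist v b +
      min (dist v a) (dist v b) * (2 * |sin ((θ a - θ b) / 2)| - 1) := by
  refine chord_add_min_le dist_nonneg dist_nonneg (by positivity)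
    (by linarith [abs_sin_le_one ((θ a - θ b) / 2)]) ?_ (hθ a b)
  rw [mul_pow, sq_abs, sin_sq_eq_half_sub]
  rw [show 2 * ((θ a - θ b) / 2) = θ a - θ b by ring]
  ring

/-- The squares sum to at most 9/4 because |e^{ix} + e^{iy} + e^{iz}|² ≥ 0; Cauchy–Schwarz then
gives 3√3/2, rounded up to 21/8. -/
lemma sum_abs_sin_half_le (x y z : ℝ) :
    |sin ((x - y) / 2)| + |sin ((x - z) / 2)| + |sin ((y - z) / 2)| ≤ 21 / 8 := by
  have e : ∀ t : ℝ, |sin (t / 2)| ^ 2 = 1 / 2 - cos t / 2 := fun t => by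
    rw [sq_abs, sin_sq_eq_half_sub, show 2 * (t / 2) = t by ring]
  have h : |sin ((x - y) / 2)| ^ 2 + |sin ((x - z) / 2)| ^ 2 + |sin ((y - z) / 2)| ^ 2 ≤ 9 / 4 := by
    rw [e, e, e, cos_sub, cos_sub, cos_sub]
    nlinarith [sq_nonneg (cos x + cos y + cos z), sq_nonneg (sin x + sin y + sin z),
      sin_sq_add_cos_sq x, sin_sq_add_cos_sq y, sin_sq_add_cos_sq z]
  generalize |sin ((x - y) / 2)| = a at *
  generalize |sin ((x - z) / 2)| = b at *
  generalize |sin ((y - z) / 2)| = c at *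
  refine le_of_sq_le_sq ?_ (by norm_num)
  nlinarith [sq_nonneg (a - b), sq_nonneg (a - c), sq_nonneg (b - c)]

/-- `B` is at most 5/4 of the total length of three spokes as soon as it is at most the weight of
the paths through the hub and its three neighbours in which one spoke is replaced by a chord. -/
lemma le_of_three_spokes
    (hθ : ∀ x y, dist x y ^ 2 = dist v x ^ 2 + dist v y ^ 2 -
        2 * dist v x * dist v y * cos (θ x - θ y)) {a b c : V} {B : ℝ}
    (ha : v ≠ a) (hb : v ≠ b) (hc : v ≠ c)
    (hab : B ≤ dist a b + min (dist v a) (dist v b) + dist v c)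
    (hac : B ≤ dist a c + min (dist v a) (dist v c) + dist v b)
    (hbc : B ≤ dist b c + min (dist v b) (dist v c) + dist v a) :
    B ≤ 5 / 4 * (dist v a + dist v b + dist v c) :=
  three_spokes (dist_pos.2 ha) (dist_pos.2 hb) (dist_pos.2 hc)
    (by linarith [sum_abs_sin_half_le (θ a) (θ b) (θ c)])
    (dist_add_min_le hθ a b) (dist_add_min_le hθ a c) (dist_add_min_le hθ b c) hab hac hbc

lemma le_of_four_spokes
    (hθ : ∀ x y, dist x y ^ 2 = dist v x ^ 2 + dist v y ^ 2 -
        2 * dist v x * dist v y * cos (θ x - θ y)) {a b c d : V} {B : ℝ}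
    (ha : v ≠ a) (hb : v ≠ b) (hc : v ≠ c) (hd : v ≠ d)
    (hab : π / 3 ≤ θ b - θ a) (hbc : π / 3 ≤ θ c - θ b) (hcd : π / 3 ≤ θ d - θ c)
    (had : θ d - θ a ≤ 4 * π / 3)
    (h₁ : B ≤ dist a b + dist c d + min (dist v a) (dist v b) + min (dist v c) (dist v d))
    (h₂ : B ≤ dist v a + dist v d + dist c d + dist b c)
    (h₃ : B ≤ dist v a + dist v c + dist c d + dist b d)
    (h₄ : B ≤ dist v d + dist v a + dist a b + dist b c)
    (h₅ : B ≤ dist v d + dist v b + dist a b + dist a c) :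
    B ≤ 5 / 4 * (dist v a + dist v b + dist v c + dist v d) := by
  have hπ := pi_pos
  have pa := dist_pos.2 ha
  have pb := dist_pos.2 hb
  have pc := dist_pos.2 hc
  have pd := dist_pos.2 hd
  have eab := dist_add_min_le hθ a b
  have ebc := dist_add_min_le hθ b c
  have ecd := dist_add_min_le hθ c d
  have eac := dist_add_min_le hθ a c
  have ebd := dist_add_min_le hθ b d
  have e : ∀ x y : V, θ x ≤ θ y → θ y - θ x ≤ 2 * π →
      |sin ((θ x - θ y) / 2)| = sin ((θ y - θ x) / 2) := fun x y h1 h2 => by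
    rw [show (θ x - θ y) / 2 = -((θ y - θ x) / 2) by ring, sin_neg, abs_neg, abs_of_nonneg]
    exact sin_nonneg_of_nonneg_of_le_pi (by linarith) (by linarith)
  rw [e _ _ (by linarith) (by linarith)] at eab ebc ecd eac ebd
  -- Any two of the three consecutive gaps add up to at most π, the third being at least π/3.
  have hsq : ∀ x y : ℝ, 0 ≤ x → 0 ≤ y → x + y ≤ π / 2 →
      (2 * sin x - 1 + 1) ^ 2 + (2 * sin y - 1 + 1) ^ 2 ≤ 4 := fun x y h1 h2 h3 => by
    nlinarith [sin_sq_add_sin_sq_le_one h1 h2 h3]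
  have q₁ := hsq ((θ b - θ a) / 2) ((θ d - θ c) / 2) (by linarith) (by linarith) (by linarith)
  have q₂ := hsq ((θ b - θ a) / 2) ((θ c - θ b) / 2) (by linarith) (by linarith) (by linarith)
  have q₃ := hsq ((θ d - θ c) / 2) ((θ c - θ b) / 2) (by linarith) (by linarith) (by linarith)
  have s₁ := sin_le_seven_eighths (x := (θ b - θ a) / 2) (by linarith) (by linarith)
  have s₂ := sin_le_seven_eighths (x := (θ d - θ c) / 2) (by linarith) (by linarith)
  have t₁ := sin_add_sin_le_seven_quarters (x := (θ b - θ a) / 2) (y := (θ d - θ b) / 2)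
    (by linarith) (by linarith) (by linarith)
  have t₂ := sin_add_sin_le_seven_quarters (x := (θ d - θ c) / 2) (y := (θ c - θ a) / 2)
    (by linarith) (by linarith) (by linarith)
  have u₁ := sin_le_one ((θ d - θ b) / 2)
  have u₂ := sin_le_one ((θ c - θ a) / 2)
  by_cases c₁ : 1 / 2 < 2 * sin ((θ b - θ a) / 2) - 1
  · exact four_spokes_aux pa pb pc pd eab ecd ebc ebd c₁ (by linarith) q₁ q₂ (by linarith)
      (by linarith) h₁ h₂ h₃
  -- The mirror image of the previous case, with the spokes in reverse order.
  by_cases c₂ : 1 / 2 < 2 * sin ((θ d - θ c) / 2) - 1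
  · rw [dist_comm c d, min_comm (dist v c), add_comm (dist v c)] at ecd
    rw [dist_comm a b, min_comm (dist v a), add_comm (dist v a)] at eab
    rw [dist_comm b c, min_comm (dist v b), add_comm (dist v b)] at ebc
    rw [dist_comm a c, min_comm (dist v a), add_comm (dist v a)] at eac
    rw [dist_comm a b, dist_comm c d, min_comm (dist v a), min_comm (dist v c)] at h₁
    rw [dist_comm a b, dist_comm b c] at h₄
    rw [dist_comm a b, dist_comm a c] at h₅
    have := four_spokes_aux (B := B) pd pc pb pa ecd eab ebc eac c₂ (by linarith) (by linarith) q₃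
      (by linarith) (by linarith) (by linarith) h₄ h₅
    linarith
  -- Both outer pairs have f ≤ 1/2, so the excess in `h₁` is at most half the sum of the two minima.
  · have m₁ := min_le_left (dist v a) (dist v b)
    have m₂ := min_le_right (dist v a) (dist v b)
    have m₃ := min_le_left (dist v c) (dist v d)
    have m₄ := min_le_right (dist v c) (dist v d)
    have m₅ : 0 < min (dist v a) (dist v b) := lt_min pa pb
    have m₆ : 0 < min (dist v c) (dist v d) := lt_min pc pd
    nlinarith

end Angles

/-! ### Shortest paths through a vertex and its children -/

section Stars

variable {V : Type*}

lemma exists_sorted_list (f : V → ℝ) (s : Finset V) : ∃ L : List V, L.Nodup ∧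
    L.Pairwise (fun a b => f a ≤ f b) ∧ L.length = s.card ∧ ∀ x, x ∈ L ↔ x ∈ s := by
  classical
  induction s using Finset.induction_on_max_value f with
  | empty => exact ⟨[], by simp⟩
  | insert a s ha hmax ih =>
    obtain ⟨L, h1, h2, h3, h4⟩ := ih
    refine ⟨L ++ [a], ?_, ?_, ?_, ?_⟩
    · rw [List.nodup_append]
      refine ⟨h1, List.nodup_singleton a, fun x hx y hy hxy => ?_⟩
      rw [List.mem_singleton.1 hy] at hxy
      exact ha (hxy ▸ (h4 x).1 hx)
    · rw [List.pairwise_append]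
      refine ⟨h2, List.pairwise_singleton _ a, fun x hx y hy => ?_⟩
      rw [List.mem_singleton.1 hy]
      exact hmax x ((h4 x).1 hx)
    · rw [List.length_append, h3, Finset.card_insert_of_notMem ha, List.length_singleton]
    · intro x
      rw [List.mem_append, List.mem_singleton, Finset.mem_insert, h4, or_comm]

variable [MetricSpace V] {v : V} {s : Finset V} {l : List V}

lemma IsShortestPathThrough.le_of_perm
    (hl : IsShortestPathThrough (insert v (s : Set V)) l) (hv : v ∉ s) {L : List V}
    (hL : L.Nodup) (hmem : ∀ x, x ∈ L ↔ x ∈ s) {l' : List V} (h : l'.Perm (v :: L)) :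
    pathWeight l ≤ pathWeight l' := by
  refine hl.2 l' ⟨h.nodup_iff.2 (List.nodup_cons.2 ⟨fun hv' => hv ((hmem v).1 hv'), hL⟩),
    fun x => ?_⟩
  rw [h.mem_iff, List.mem_cons, hmem]
  rfl

lemma sum_dist_eq_sum_map {L : List V} (hL : L.Nodup) (hmem : ∀ x, x ∈ L ↔ x ∈ s) :
    ∑ u ∈ s, dist v u = (L.map (dist v)).sum := by
  classical
  rw [← List.sum_toFinset _ hL]
  congr 1
  ext x
  rw [List.mem_toFinset, hmem]

lemma IsShortestPathThrough.pathWeight_le_of_card_le_one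
    (hl : IsShortestPathThrough (insert v (s : Set V)) l) (hv : v ∉ s) (hs : s.card ≤ 1) :
    pathWeight l ≤ 5 / 4 * ∑ u ∈ s, dist v u := by
  obtain ⟨L, h1, -, h3, h4⟩ := exists_sorted_list (fun _ => 0) s
  rw [sum_dist_eq_sum_map h1 h4]
  rw [← h3] at hs
  have hmin := fun l' => hl.le_of_perm hv h1 h4 (l' := l')
  match L, hs with
  | [], _ => simpa [pathWeight] using hmin [v] (List.Perm.refl _)
  | [a], _ =>
    have := hmin [v, a] (List.Perm.refl _)
    simp only [pathWeight, List.map_cons, List.map_nil, List.sum_cons, List.sum_nil] at this ⊢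
    linarith [dist_nonneg (x := v) (y := a)]

open Real in
/-- A vertex `v` with at most four neighbours besides `p`, all at pairwise angles at least `π / 3`
(as in a minimum spanning tree): a shortest path through `v` and these neighbours weighs at most
5/4 of the star that joins `v` to them. -/
lemma IsShortestPathThrough.pathWeight_le {p : V} {θ : V → ℝ}
    (hl : IsShortestPathThrough (insert v (s : Set V)) l)
    (hθ : ∀ x y, dist x y ^ 2 = dist v x ^ 2 + dist v y ^ 2 -
        2 * dist v x * dist v y * cos (θ x - θ y))
    (hθ0 : ∀ x, 0 < θ x ∧ θ x ≤ 2 * π) (hθp : θ p = 2 * π) (hvp : v ≠ p) (hv : v ∉ s) (hp : p ∉ s)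
    (hd : ∀ a b, a ∈ insert p (s : Set V) → b ∈ insert p (s : Set V) → a ≠ b →
      dist v a ≤ dist a b)
    (hs : s.card ≤ 4) :
    pathWeight l ≤ 5 / 4 * ∑ u ∈ s, dist v u := by
  classical
  obtain ⟨L, h1, h2, h3, h4⟩ := exists_sorted_list θ s
  rw [sum_dist_eq_sum_map h1 h4]
  rw [← h3] at hs
  have hmin := fun l' hc => hl.le_of_perm hv h1 h4 (l' := l') (List.perm_iff_count.2 hc)
  have hne : ∀ x ∈ L, v ≠ x := fun x hx hvx => hv ((h4 v).1 (hvx ▸ hx))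
  have hcos : ∀ x y, x ∈ insert p (s : Set V) → y ∈ insert p (s : Set V) → x ≠ y →
      cos (θ x - θ y) ≤ 1 / 2 := fun x y hx hy hxy => by
    have hn : ∀ z, z ∈ insert p (s : Set V) → v ≠ z := by
      rintro z (rfl | hz)
      exacts [hvp, fun h => hv (h ▸ hz)]
    exact cos_sub_le_half hθ (hn x hx) (hn y hy) (hd x y hx hy hxy)
      (by rw [dist_comm x y]; exact hd y x hy hx hxy.symm)
  have hgap : ∀ x y, x ∈ L → y ∈ L → x ≠ y → θ x ≤ θ y → π / 3 ≤ θ y - θ x :=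
    fun x y hx hy hxy hle => pi_div_three_le_of_cos_le_half (by linarith)
      (hcos y x (.inr ((h4 y).1 hy)) (.inr ((h4 x).1 hx)) hxy.symm)
  -- The ray to `p` sits at both ends of the angular interval, so it keeps the neighbours π/3 away
  -- from each end.
  have hedge : ∀ x ∈ L, π / 3 ≤ θ x ∧ θ x ≤ 5 * π / 3 := fun x hx => by
    have h := hcos x p (.inr ((h4 x).1 hx)) (.inl rfl) (fun h => hp (h ▸ (h4 x).1 hx))
    rw [hθp, cos_sub_two_pi] at h
    exact ⟨pi_div_three_le_of_cos_le_half (hθ0 x).1.le h,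
      le_five_pi_div_three_of_cos_le_half (hθ0 x).2 h⟩
  match L, hs with
  | [], _ =>
    rw [← sum_dist_eq_sum_map h1 h4]
    exact hl.pathWeight_le_of_card_le_one hv (by simp [← h3])
  | [a], _ =>
    rw [← sum_dist_eq_sum_map h1 h4]
    exact hl.pathWeight_le_of_card_le_one hv (by simp [← h3])
  | [a, b], _ =>
    have := hmin [a, v, b] (by grind)
    simp only [pathWeight, List.map_cons, List.map_nil, List.sum_cons, List.sum_nil,
      dist_comm a v] at this ⊢
    linarith [dist_nonneg (x := v) (y := a), dist_nonneg (x := v) (y := b)]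
  | [a, b, c], _ =>
    -- Both orientations of each chord are needed, so that its nearer end can be put next to `v`.
    have e1 := hmin [a, b, v, c] fun _ => by simp only [List.count_cons]; ring
    have e2 := hmin [b, a, v, c] fun _ => by simp only [List.count_cons]; ring
    have e3 := hmin [a, c, v, b] fun _ => by simp only [List.count_cons]; ring
    have e4 := hmin [c, a, v, b] fun _ => by simp only [List.count_cons]; ring
    have e5 := hmin [b, c, v, a] fun _ => by simp only [List.count_cons]; ring
    have e6 := hmin [c, b, v, a] fun _ => by simp only [List.count_cons]; ring
    simp only [pathWeight, List.map_cons, List.map_nil, List.sum_cons, List.sum_nil,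
      dist_comm a v, dist_comm b v, dist_comm c v, dist_comm b a, dist_comm c b,
      dist_comm c a] at e1 e2 e3 e4 e5 e6 ⊢
    have := le_of_three_spokes (B := pathWeight l) hθ (hne a (by simp)) (hne b (by simp))
      (hne c (by simp))
      (by rcases min_choice (dist v a) (dist v b) with h | h <;> rw [h] <;> linarith)
      (by rcases min_choice (dist v a) (dist v c) with h | h <;> rw [h] <;> linarith)
      (by rcases min_choice (dist v b) (dist v c) with h | h <;> rw [h] <;> linarith)
    linarith
  | [a, b, c, d], _ =>
    have e1 := hmin [a, b, v, c, d] fun _ => by simp only [List.count_cons]; ring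
    have e2 := hmin [a, b, v, d, c] fun _ => by simp only [List.count_cons]; ring
    have e3 := hmin [b, a, v, c, d] fun _ => by simp only [List.count_cons]; ring
    have e4 := hmin [b, a, v, d, c] fun _ => by simp only [List.count_cons]; ring
    have e5 := hmin [a, v, d, c, b] fun _ => by simp only [List.count_cons]; ring
    have e6 := hmin [a, v, c, d, b] fun _ => by simp only [List.count_cons]; ring
    have e7 := hmin [d, v, a, b, c] fun _ => by simp only [List.count_cons]; ring
    have e8 := hmin [d, v, b, a, c] fun _ => by simp only [List.count_cons]; ring
    simp only [pathWeight, List.map_cons, List.map_nil, List.sum_cons, List.sum_nil,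
      dist_comm a v, dist_comm b v, dist_comm d v, dist_comm b a, dist_comm c b,
      dist_comm d b, dist_comm d c] at e1 e2 e3 e4 e5 e6 e7 e8 ⊢
    have g : π / 3 ≤ θ b - θ a ∧ π / 3 ≤ θ c - θ b ∧ π / 3 ≤ θ d - θ c := by
      simp only [List.nodup_cons, List.pairwise_cons, List.mem_cons] at h1 h2
      refine ⟨hgap a b ?_ ?_ ?_ ?_, hgap b c ?_ ?_ ?_ ?_, hgap c d ?_ ?_ ?_ ?_⟩ <;> grind
    have had : θ d - θ a ≤ 4 * π / 3 := by
      linarith [(hedge a (by simp)).1, (hedge d (by simp)).2]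
    have := le_of_four_spokes (B := pathWeight l) hθ (hne a (by simp)) (hne b (by simp))
      (hne c (by simp)) (hne d (by simp)) g.1 g.2.1 g.2.2 had
      (by
        rcases min_choice (dist v a) (dist v b) with h | h <;>
        rcases min_choice (dist v c) (dist v d) with h' | h' <;> rw [h, h'] <;> linarith)
      (by linarith) (by linarith) (by linarith) (by linarith)
    linarith

end Stars

/-- In a minimum spanning tree of maximum degree 5 in the plane, rooted at a leaf, a shortest path
through a vertex and its children weighs at most 5/4 of the edges to the children. -/
lemma pathWeight_le_of_isMST {V : Finset (EuclideanSpace ℝ (Fin 2))} {T : SimpleGraph V}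
    (hT : IsMST T) (hdeg : DegreeAtMost T 5) {r : V} (hr : IsLeaf T r) {v : V} {l : List V}
    (hl : IsShortestPathThrough (insert v (children T r v : Set V)) l) :
    pathWeight l ≤ 5 / 4 * ∑ u ∈ children T r v, dist v u := by
  -- The root has no parent to bound the arc, but being a leaf it has at most one child.
  by_cases hvr : v = r
  · subst hvr
    exact hl.pathWeight_le_of_card_le_one (notMem_children_self T v v)
      ((card_children_le_degree T v v).trans hr)
  obtain ⟨p, hp⟩ := exists_mem_children hT.1.connected hvr
  have hp' := mem_children.1 hp
  have hvp : v ≠ p := hp'.1.ne.symm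
  obtain ⟨θ, h0, hθp, hθ⟩ := exists_angle_around (Subtype.coe_injective.ne hvp)
  have hadj : ∀ a, a ∈ insert p (children T r v : Set V) → T.Adj v a := by
    rintro a (rfl | ha)
    exacts [hp'.1.symm, (mem_children.1 ha).1]
  refine hl.pathWeight_le (p := p) (θ := fun x => θ x) (fun x y => hθ x y) (fun x => h0 x) hθp hvp
    (notMem_children_self T r v) (fun h => ?_)
    (fun a b ha hb hab => hT.dist_le (hadj a ha) (hadj b hb) hab)
    (Nat.lt_succ_iff.1 ((card_children_lt_degree hp).trans_le (hdeg v)))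
  have := (mem_children.1 h).2
  omega

end EuclideanMST

theorem mainTheorem2 (V : Finset (EuclideanSpace ℝ (Fin 2))) (T : SimpleGraph V)
    (hT : EuclideanMST.IsMST T) (hdeg : EuclideanMST.DegreeAtMost T 5) :
    (∃ r : V, EuclideanMST.IsLeaf T r) ∧
    ∀ r : V, EuclideanMST.IsLeaf T r →
      (∃ P : V → List V, EuclideanMST.IsShortestPathFamily T r P) ∧
      ∀ P : V → List V, EuclideanMST.IsShortestPathFamily T r P →
        (∀ v : V, EuclideanMST.pathWeight (P v) ≤
          (5 / 4 : ℝ) * ∑ u ∈ EuclideanMST.children T r v, dist v u) ∧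
        (EuclideanMST.unionOfPaths P).IsTree ∧
        EuclideanMST.DegreeAtMost (EuclideanMST.unionOfPaths P) 4 ∧
        EuclideanMST.weight (EuclideanMST.unionOfPaths P) ≤
          (5 / 4 : ℝ) * EuclideanMST.weight T := by
  refine ⟨EuclideanMST.exists_isLeaf hT.1, fun r hr => ⟨?_, fun P hP => ?_⟩⟩
  · choose P hP using fun v => EuclideanMST.exists_isShortestPathThrough
      (insert v (EuclideanMST.children T r v : Set V))
    exact ⟨P, hP⟩
  have hw := fun v => EuclideanMST.pathWeight_le_of_isMST hT hdeg hr (hP v)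
  refine ⟨hw, EuclideanMST.unionOfPaths_isTree hT.1 hP,
    EuclideanMST.unionOfPaths_degreeAtMost hT.1 hP,
    (EuclideanMST.weight_unionOfPaths_le P).trans
      ((Finset.sum_le_sum fun v _ => hw v).trans ?_)⟩
  rw [← Finset.mul_sum]
  exact mul_le_mul_of_nonneg_left (EuclideanMST.sum_dist_children_le_weight T r) (by norm_num)
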